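/- Let $G=(V,E)$ be a finite connected graph (parallel edges allowed), $T\subseteq V$ with $|T|$ even, and $c:E\to\mathbb{R}_+$. For $X\subseteq V$ let $\delta(X)$ be the set of edges with exactly one endpoint in $X$, and for a partition $\mathcal{W}$ of $V$ let $\delta(\mathcal{W})=\bigcup_{W\in\mathcal{W}}\delta(W)$. For $F\subseteq E$ let $T_F:=\{v\in V: |\delta(v)\cap F| \text{ is odd}\}$. A $T'$-join $(T'\subseteq V)$ is a set $J\subseteq E$ with $T_J=T'$, and $\tau(G,T',c)$ denotes the minimum of $c(J)=\sum_{e\in J}c(e)$ over all $T'$-joins $J$ of $G$. For a spanning tree $F$ let $F(T)$ be the unique $T$-join contained in $F$. Let $x^*$ minimize $c^\top x$ over the polyhedron $P(G,T)$ of all $x\in\mathbb{R}^E$ with $x(\delta(W))\ge 2$ for all $\emptyset\neq W\subsetneq V$ with $|W\cap T|$ even, $x(\delta(\mathcal{W}))\ge|\mathcal{W}|-1$ for all partitions $\mathcal{W}$ of $V$, and $0\le x(e)\le 2$ for all $e\in E$. Let $\mathcal{F}_{>0}$ be a set of spanning trees of $G$ with coefficients $\lambda_F>0$ $(F\in\mathcal{F}_{>0})$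 such that $\sum_{F\in\mathcal{F}_{>0}}\lambda_F=1$ and $\sum_{F\in\mathcal{F}_{>0}}\lambda_F\chi_F\le x^*$, where $\chi_F$ is the incidence vector of $F$. Let $\mathcal{F}$ be the random spanning tree with $\Pr(\mathcal{F}=F)=\lambda_F$, and let $q^*(e):=\Pr(e\in\mathcal{F}\setminus\mathcal{F}(T))$ for $e\in E$. Then $$E[\tau(G,T_{\mathcal{F}}\triangle T,c)]\ \le\ \min\Big\{c^\top x^*-\frac{c^\top q^*}{2},\ c^\top q^*\Big\}\ \le\ \frac{2}{3}\,c^\top x^*.$$ -/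

import Mathlib

open Finset
open scoped symmDiff

/-- A graph with vertex set `V` and edge set `E`: every edge `e` has an unordered pair `ends e` of
endpoints. Parallel edges are allowed (and loops, which lie in no cut and in no spanning tree). -/
structure MultiGraph (V E : Type*) where
  ends : E → Sym2 V

namespace MultiGraph

variable {V E : Type*} [Fintype V] [DecidableEq V] [Fintype E] [DecidableEq E]

/-- The simple graph on `V` in which two distinct vertices are adjacent when some edge in `F`
joins them. -/
def support (G : MultiGraph V E) (F : Finset E) : SimpleGraph V :=
  SimpleGraph.fromEdgeSet (G.ends '' (F : Set E))

/-- `G` is connected. -/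
def Connected (G : MultiGraph V E) : Prop := (G.support univ).Connected

/-- `(V, F)` is a tree: it has no loops, no parallel edges, and as a simple graph it is connected
and acyclic. -/
def IsSpanningTree (G : MultiGraph V E) (F : Finset E) : Prop :=
  (∀ e ∈ F, ¬ (G.ends e).IsDiag) ∧ Set.InjOn G.ends (F : Set E) ∧ (G.support F).IsTree

/-- `δ(X)`: the edges with exactly one endpoint in `X`. -/
def delta (G : MultiGraph V E) (X : Finset V) : Finset E :=
  univ.filter fun e => ∃ u ∈ X, ∃ v ∉ X, G.ends e = s(u, v)

/-- `δ(𝒲)` for a partition `𝒲` of `V`: the union of the cuts `δ(W)`, `W ∈ 𝒲`. -/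
def deltaPartition (G : MultiGraph V E) (𝒲 : Finpartition (univ : Finset V)) : Finset E :=
  𝒲.parts.biUnion G.delta

/-- `T_F`: the vertices `v` for which `|δ(v) ∩ F|` is odd. -/
def oddVertices (G : MultiGraph V E) (F : Finset E) : Finset V :=
  univ.filter fun v => Odd (G.delta {v} ∩ F).card

/-- `J` is a `T`-join. -/
def IsTJoin (G : MultiGraph V E) (T : Finset V) (J : Finset E) : Prop :=
  G.oddVertices J = T

/-- `τ(G, T, c)`: the minimum length of a `T`-join of `G`. (It is attained as soon as `G` has a
`T`-join, see `isLeast_tau`; in a connected graph this is the case for all `T` of even size.) -/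
noncomputable def tau (G : MultiGraph V E) (T : Finset V) (c : E → ℝ) : ℝ :=
  sInf ((fun J : Finset E => ∑ e ∈ J, c e) '' {J | G.IsTJoin T J})

theorem isLeast_tau (G : MultiGraph V E) (T : Finset V) (c : E → ℝ)
    (h : ∃ J, G.IsTJoin T J) :
    IsLeast ((fun J : Finset E => ∑ e ∈ J, c e) '' {J | G.IsTJoin T J}) (G.tau T c) := by
  obtain ⟨J, hJ⟩ := h
  have hfin : ((fun J : Finset E => ∑ e ∈ J, c e) '' {J | G.IsTJoin T J}).Finite :=
    (Set.toFinite _).image _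
  exact ⟨Set.Nonempty.csInf_mem ⟨_, J, hJ, rfl⟩ hfin, fun a ha => csInf_le hfin.bddBelow ha⟩

/-- `F(T)`: the unique `T`-join of `G` that is contained in the spanning tree `F`. -/
noncomputable def treeJoin (G : MultiGraph V E) (T : Finset V) (F : Finset E) : Finset E :=
  Classical.epsilon fun J => J ⊆ F ∧ G.IsTJoin T J

/-- The polyhedron `P(G, T)`. -/
def tourPolyhedron (G : MultiGraph V E) (T : Finset V) : Set (E → ℝ) :=
  {x | (∀ W : Finset V, W ≠ ∅ → W ⊂ univ → Even (W ∩ T).card → 2 ≤ ∑ e ∈ G.delta W, x e) ∧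
    (∀ 𝒲 : Finpartition (univ : Finset V),
      (𝒲.parts.card : ℝ) - 1 ≤ ∑ e ∈ G.deltaPartition 𝒲, x e) ∧
    ∀ e, 0 ≤ x e ∧ x e ≤ 2}

/-- `𝓕` is a set of spanning trees of `G`, with positive coefficients `lam F`, `F ∈ 𝓕`, of sum `1`,
such that `∑ lam F • χ_F ≤ x`. The coefficients are the distribution of a random spanning tree,
and `𝓕` is its support. -/
structure IsDominatedTreeDistribution (G : MultiGraph V E) (x : E → ℝ)
    (𝓕 : Finset (Finset E)) (lam : Finset E → ℝ) : Prop where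
  isSpanningTree : ∀ F ∈ 𝓕, G.IsSpanningTree F
  pos : ∀ F ∈ 𝓕, 0 < lam F
  sum_eq_one : ∑ F ∈ 𝓕, lam F = 1
  dominated : ∀ e, ∑ F ∈ 𝓕 with e ∈ F, lam F ≤ x e

end MultiGraph

/-- The mean value of `X` for the random set that is `F` with probability `lam F`, `F ∈ 𝓕`. -/
def treeExpectation {E : Type*} (𝓕 : Finset (Finset E)) (lam : Finset E → ℝ)
    (X : Finset E → ℝ) : ℝ :=
  ∑ F ∈ 𝓕, lam F * X F

namespace MultiGraph

variable {V E : Type*} [Fintype V] [DecidableEq V] [Fintype E] [DecidableEq E]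

/-- `q*(e)`: the probability that `e` is in `F \ F(T)`. -/
noncomputable def qStar (G : MultiGraph V E) (T : Finset V) (𝓕 : Finset (Finset E))
    (lam : Finset E → ℝ) (e : E) : ℝ :=
  ∑ F ∈ 𝓕 with e ∈ F \ G.treeJoin T F, lam F

end MultiGraph

set_option linter.unusedSectionVars false

/-! For a single tree F there are two bounds on τ for T_F △ T. First, F \ F(T) is itself a (T_F △
T)-join; averaging gives c·q*. Second, x*/2 + χ_{F(T)}/2 lies in the (T_F △ T)-join polyhedron
(`tau_le_half`): if |W ∩ T| is even, x* is at least 2 on the cut of W; if it is odd, x* is at least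
1 there and F(T) meets the cut. So τ ≤ (c·x* + c(F(T)))/2, while domination gives E[c(F(T))] ≤ c·x*
- c·q*. Weights 2/3 and 1/3 on the two bounds cancel q* and leave (2/3) c·x*.

The second bound rests on the Edmonds–Johnson theorem (`Feasible.exists_join_le`), proved by
induction on the number of strict inequalities at y. Take a T-join J in the support of y that meets
every tight T-cut once. If J is dearer than y, moving y away from χ_J lowers the cost until a
further inequality becomes tight.

Such a J exists by `Feasible.hasTightJoins`, where an edge of a tight cut may be prescribed; this
stronger form is what makes gluing possible. An edge of weight at least 1 is contracted. A tight cut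
with positive edges inside both sides is split by contracting each side, and the two joins are glued
along their common cut edge. Otherwise all tight cuts are stars, and either y can be moved or its
support is 2-regular. -/

namespace TJoin

variable {V E : Type*} [Fintype V] [DecidableEq V] [Fintype E] [DecidableEq E]

/-! ### Cuts and degree parities modulo two -/

/-- The cut of `W` in the graph in which the edge `e` joins `a e` and `b e`. -/
def cut (a b : E → V) (W : Finset V) : Finset E :=
  univ.filter fun e => ¬ (a e ∈ W ↔ b e ∈ W)

theorem mem_cut {a b : E → V} {W : Finset V} {e : E} :
    e ∈ cut a b W ↔ ¬ (a e ∈ W ↔ b e ∈ W) := by simp [cut]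

theorem cut_compl (a b : E → V) (W : Finset V) : cut a b Wᶜ = cut a b W := by
  ext e; simp only [mem_cut, mem_compl]; tauto

theorem cut_univ (a b : E → V) : cut a b univ = ∅ := by
  ext e; simp [mem_cut]

/-- The parities of the degrees of an edge set. -/
def bdry (a b : E → V) (J : Finset E) (v : V) : ZMod 2 :=
  ∑ e ∈ J, ((if a e = v then 1 else 0) + (if b e = v then 1 else 0))

/-- Handshake modulo two: in the sum over `W`, an edge inside `W` is counted twice and an edge of
the cut once. -/
theorem card_cut_inter (a b : E → V) (J : Finset E) (W : Finset V) :
    (((cut a b W ∩ J).card : ℕ) : ZMod 2) = ∑ v ∈ W, bdry a b J v := by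
  unfold bdry
  rw [sum_comm, inter_comm, ← filter_mem_eq_inter, card_filter, Nat.cast_sum]
  refine sum_congr rfl fun e _ => ?_
  rw [sum_add_distrib, sum_ite_eq, sum_ite_eq]
  by_cases h1 : a e ∈ W <;> by_cases h2 : b e ∈ W <;> simp [mem_cut, h1, h2]
  decide

theorem card_star_inter (a b : E → V) (J : Finset E) (v : V) :
    (((cut a b {v} ∩ J).card : ℕ) : ZMod 2) = bdry a b J v := by
  rw [card_cut_inter, sum_singleton]

theorem zmod_two_add_self (x : ZMod 2) : x + x = 0 := by revert x; decide

theorem zmod_two_eq_one {x : ZMod 2} (h : x ≠ 0) : x = 1 := by revert x; decide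

theorem bdry_symmDiff (a b : E → V) (J K : Finset E) (v : V) :
    bdry a b (J ∆ K) v = bdry a b J v + bdry a b K v := by
  unfold bdry
  set f : E → ZMod 2 := fun e => (if a e = v then 1 else 0) + (if b e = v then 1 else 0)
  have h1 : J ∆ K = (J \ K) ∪ (K \ J) := rfl
  rw [h1, sum_union (disjoint_sdiff_sdiff), ← sum_inter_add_sum_sdiff J K f,
    ← sum_inter_add_sum_sdiff K J f, inter_comm K J]
  linear_combination -(zmod_two_add_self (∑ e ∈ J ∩ K, f e))

/-- A `T`-join exists in `F` if each union of components of `F` is even. -/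
theorem exists_bdry_eq (a b : E → V) (T : V → ZMod 2) (F : Finset E)
    (h : ∀ W, cut a b W ∩ F = ∅ → ∑ v ∈ W, T v = 0) :
    ∃ J ⊆ F, bdry a b J = T := by
  let S : Submodule (ZMod 2) (V → ZMod 2) :=
    { carrier := {t | ∃ J ⊆ F, bdry a b J = t}
      zero_mem' := ⟨∅, empty_subset _, by ext v; simp [bdry]⟩
      add_mem' := by
        rintro _ _ ⟨J, hJ, rfl⟩ ⟨K, hK, rfl⟩
        refine ⟨J ∆ K, ?_, funext fun v => bdry_symmDiff a b J K v⟩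
        exact union_subset (sdiff_subset.trans hJ) (sdiff_subset.trans hK)
      smul_mem' := by
        rintro c _ ⟨J, hJ, rfl⟩
        by_cases hc : c = 0
        · exact ⟨∅, empty_subset _, by ext v; simp [bdry, hc]⟩
        · exact ⟨J, hJ, by rw [zmod_two_eq_one hc, one_smul]⟩ }
  by_contra hT
  have hT' : T ∉ S := hT
  -- Duality: a functional that separates `T` from `S` is summation over some `W`. Vanishing on
  -- single edges of `F` says that no edge of `F` crosses `W`, so the hypothesis applies.
  obtain ⟨f, hfT, hfS⟩ := Submodule.exists_le_ker_of_notMem hT'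
  let W : Finset V := univ.filter fun v => f (Pi.single v 1) ≠ 0
  have hf : ∀ t, f t = ∑ v ∈ W, t v := by
    intro t
    conv_lhs => rw [← Finset.univ_sum_single t, map_sum]
    rw [sum_filter]
    refine sum_congr rfl fun v _ => ?_
    have h1 : (Pi.single v (t v) : V → ZMod 2) = t v • Pi.single v 1 := by
      rw [← Pi.single_smul]; simp
    rw [h1, map_smul]
    by_cases h0 : f (Pi.single v 1) = 0
    · simp [h0]
    · simp [zmod_two_eq_one h0]
  refine hfT ?_
  rw [hf]
  refine h W (eq_empty_of_forall_notMem fun e he => ?_)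
  rw [mem_inter] at he
  have h1 : f (bdry a b {e}) = 0 := hfS ⟨{e}, singleton_subset_iff.2 he.2, rfl⟩
  rw [hf, ← card_cut_inter, inter_singleton_of_mem he.1] at h1
  simp at h1

/-! ### The `T`-join polyhedron and its tight cuts -/

/-- `y` is nonnegative and at least one on each `T`-cut. -/
structure Feasible (a b : E → V) (T : V → ZMod 2) (y : E → ℝ) : Prop where
  nonneg : ∀ e, 0 ≤ y e
  one_le : ∀ W, ∑ v ∈ W, T v ≠ 0 → 1 ≤ ∑ e ∈ cut a b W, y e

/-- The cut of `W` is a `T`-cut on which `y` is one. -/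
def Tight (a b : E → V) (T : V → ZMod 2) (y : E → ℝ) (W : Finset V) : Prop :=
  ∑ v ∈ W, T v ≠ 0 ∧ ∑ e ∈ cut a b W, y e = 1

/-- The edges, other than loops, on which `y` is positive. -/
noncomputable def posEdges (a b : E → V) (y : E → ℝ) : Finset E :=
  univ.filter fun e => 0 < y e ∧ a e ≠ b e

/-- The `T`-cuts on which `y` is not one. -/
noncomputable def looseCuts (a b : E → V) (T : V → ZMod 2) (y : E → ℝ) : Finset (Finset E) :=
  (univ.filter fun W : Finset V => ∑ v ∈ W, T v ≠ 0 ∧ ∑ e ∈ cut a b W, y e ≠ 1).image (cut a b)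

/-- The number of edges and `T`-cuts whose inequalities are strict. -/
noncomputable def slackness (a b : E → V) (T : V → ZMod 2) (y : E → ℝ) : ℕ :=
  (posEdges a b y).card + (looseCuts a b T y).card

/-- `J` is a `T`-join of positive edges that meets each tight `T`-cut in one edge. -/
structure IsTightJoin (a b : E → V) (T : V → ZMod 2) (y : E → ℝ) (J : Finset E) : Prop where
  subset : J ⊆ posEdges a b y
  bdry_eq : bdry a b J = T
  card_eq : ∀ W, Tight a b T y W → (cut a b W ∩ J).card = 1

/-- Each positive edge in a tight cut lies in a tight join. -/
def HasTightJoins (a b : E → V) (T : V → ZMod 2) (y : E → ℝ) : Prop :=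
  ∀ e W, 0 < y e → Tight a b T y W → e ∈ cut a b W → ∃ J, IsTightJoin a b T y J ∧ e ∈ J

variable {a b : E → V} {T : V → ZMod 2} {y : E → ℝ}

theorem mem_posEdges {e : E} : e ∈ posEdges a b y ↔ 0 < y e ∧ a e ≠ b e := by simp [posEdges]

theorem mem_posEdges_of_mem_cut {e : E} {W : Finset V} (h : 0 < y e) (he : e ∈ cut a b W) :
    e ∈ posEdges a b y :=
  mem_posEdges.2 ⟨h, fun hab => mem_cut.1 he (by rw [hab])⟩

theorem Feasible.sum_univ (h : Feasible a b T y) : ∑ v, T v = 0 := by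
  by_contra h0
  have := h.one_le _ h0
  rw [cut_univ, sum_empty] at this
  linarith

theorem sum_compl_eq (h : ∑ v, T v = 0) (W : Finset V) : ∑ v ∈ Wᶜ, T v = ∑ v ∈ W, T v := by
  have h1 := sum_add_sum_compl W T
  rw [h] at h1
  linear_combination h1 - zmod_two_add_self (∑ v ∈ W, T v)

theorem Tight.compl (hy : Feasible a b T y) {W : Finset V} (h : Tight a b T y W) :
    Tight a b T y Wᶜ := by
  rw [Tight, cut_compl, sum_compl_eq hy.sum_univ]; exact h

theorem Feasible.exists_join (hy : Feasible a b T y) :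
    ∃ J ⊆ posEdges a b y, bdry a b J = T := by
  refine exists_bdry_eq a b T _ fun W hW => ?_
  by_contra h0
  have h1 := hy.one_le W h0
  have h2 : ∑ e ∈ cut a b W, y e = 0 := by
    refine sum_eq_zero fun e he => le_antisymm (not_lt.1 fun h => ?_) (hy.nonneg e)
    have : e ∈ cut a b W ∩ posEdges a b y := mem_inter.2 ⟨he, mem_posEdges_of_mem_cut h he⟩
    rw [hW] at this
    exact notMem_empty _ this
  linarith

theorem Tight.exists_pos {W : Finset V} (h : Tight a b T y W) : ∃ e ∈ cut a b W, 0 < y e :=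
  exists_lt_of_sum_lt (by rw [h.2]; simp)

theorem HasTightJoins.exists_isTightJoin (hy : Feasible a b T y) (h : HasTightJoins a b T y) :
    ∃ J, IsTightJoin a b T y J := by
  by_cases hW : ∃ W, Tight a b T y W
  · obtain ⟨W, hW⟩ := hW
    obtain ⟨e, he, hpos⟩ := hW.exists_pos
    obtain ⟨J, hJ, -⟩ := h e W hpos hW he
    exact ⟨J, hJ⟩
  · obtain ⟨J, hJ, hT⟩ := hy.exists_join
    exact ⟨J, hJ, hT, fun W h => absurd ⟨W, h⟩ hW⟩

/-- If the edge `e` has weight at least one, then a tight cut has no other positive edge. -/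
theorem Tight.eq_of_one_le (hy : Feasible a b T y) {W : Finset V} (hW : Tight a b T y W)
    {e f : E} (he : e ∈ cut a b W) (h1 : 1 ≤ y e) (hf : f ∈ cut a b W) (hf0 : 0 < y f) :
    f = e := by
  by_contra hne
  have h2 : ∑ g ∈ ({e, f} : Finset E), y g ≤ ∑ g ∈ cut a b W, y g :=
    sum_le_sum_of_subset_of_nonneg (by
      intro g hg
      rcases mem_insert.1 hg with rfl | hg
      · exact he
      · rw [mem_singleton.1 hg]; exact hf) fun g _ _ => hy.nonneg g
  rw [sum_pair (Ne.symm hne), hW.2] at h2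
  linarith

/-! ### Contraction -/

/-- The image of `T` under a map of the vertices. -/
def push (φ : V → V) (T : V → ZMod 2) (v : V) : ZMod 2 := ∑ u with φ u = v, T u

/-- The preimage of `W`. -/
def pre (φ : V → V) (W : Finset V) : Finset V := univ.filter fun v => φ v ∈ W

theorem mem_pre {φ : V → V} {W : Finset V} {v : V} : v ∈ pre φ W ↔ φ v ∈ W := by simp [pre]

theorem sum_push (φ : V → V) (T : V → ZMod 2) (W : Finset V) :
    ∑ v ∈ W, push φ T v = ∑ v ∈ pre φ W, T v := by
  unfold push pre
  rw [← sum_fiberwise_of_maps_to (s := univ.filter fun v => φ v ∈ W) (t := W) (g := φ)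
    (fun v hv => (mem_filter.1 hv).2)]
  refine sum_congr rfl fun v hv => sum_congr ?_ fun _ _ => rfl
  ext u
  simp only [mem_filter, mem_univ, true_and]
  exact ⟨fun h => ⟨h ▸ hv, h⟩, fun h => h.2⟩

theorem cut_comp (φ : V → V) (a b : E → V) (W : Finset V) :
    cut (φ ∘ a) (φ ∘ b) W = cut a b (pre φ W) := by
  ext e; simp [mem_cut, mem_pre]

theorem Feasible.comp (h : Feasible a b T y) (φ : V → V) :
    Feasible (φ ∘ a) (φ ∘ b) (push φ T) y := by
  refine ⟨h.nonneg, fun W hW => ?_⟩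
  rw [cut_comp]
  rw [sum_push] at hW
  exact h.one_le _ hW

theorem tight_comp {φ : V → V} {W : Finset V} :
    Tight (φ ∘ a) (φ ∘ b) (push φ T) y W ↔ Tight a b T y (pre φ W) := by
  rw [Tight, Tight, cut_comp, sum_push]

theorem posEdges_comp_subset (φ : V → V) : posEdges (φ ∘ a) (φ ∘ b) y ⊆ posEdges a b y := by
  intro e he
  rw [mem_posEdges] at he ⊢
  exact ⟨he.1, fun h => he.2 (congrArg φ h)⟩

/-- Vertex sets with the same preimage give the same edge set, so counting loose cuts as edge sets
makes this a plain inclusion. -/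
theorem looseCuts_comp_subset (φ : V → V) :
    looseCuts (φ ∘ a) (φ ∘ b) (push φ T) y ⊆ looseCuts a b T y := by
  intro D hD
  simp only [looseCuts, mem_image, mem_filter, mem_univ, true_and] at hD ⊢
  obtain ⟨W, ⟨h1, h2⟩, rfl⟩ := hD
  rw [cut_comp] at h2 ⊢
  rw [sum_push] at h1
  exact ⟨_, ⟨h1, h2⟩, rfl⟩

/-- Contraction creates no new cuts and turns `e` into a loop, which `posEdges` does not count. -/
theorem slackness_comp_lt {φ : V → V} {e : E} (he : e ∈ posEdges a b y)
    (hφ : φ (a e) = φ (b e)) :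
    slackness (φ ∘ a) (φ ∘ b) (push φ T) y < slackness a b T y := by
  refine add_lt_add_of_lt_of_le (card_lt_card ?_) (card_le_card (looseCuts_comp_subset φ))
  refine Finset.ssubset_iff_subset_ne.2 ⟨posEdges_comp_subset φ, fun h => ?_⟩
  rw [← h, mem_posEdges] at he
  exact he.2 hφ

theorem IsTightJoin.card_eq_of_pre {φ : V → V} {J : Finset E} {W : Finset V}
    (hJ : IsTightJoin (φ ∘ a) (φ ∘ b) (push φ T) y J) (hφ : pre φ W = W)
    (hW : Tight a b T y W) : (cut a b W ∩ J).card = 1 := by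
  have := hJ.card_eq W (tight_comp.2 (hφ.symm ▸ hW))
  rwa [cut_comp, hφ] at this

theorem IsTightJoin.sum_bdry_of_pre {φ : V → V} {J : Finset E} {W : Finset V}
    (hJ : IsTightJoin (φ ∘ a) (φ ∘ b) (push φ T) y J) (hφ : pre φ W = W) :
    ∑ v ∈ W, bdry a b J v = ∑ v ∈ W, T v := by
  rw [← card_cut_inter]
  conv_lhs => rw [← hφ]
  rw [← cut_comp, card_cut_inter, hJ.bdry_eq, sum_push, hφ]

theorem HasTightJoins.exists_mem_of_pre {φ : V → V} {e : E} {W : Finset V}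
    (h : HasTightJoins (φ ∘ a) (φ ∘ b) (push φ T) y) (hφ : pre φ W = W) (he : 0 < y e)
    (hW : Tight a b T y W) (heW : e ∈ cut a b W) :
    ∃ J, IsTightJoin (φ ∘ a) (φ ∘ b) (push φ T) y J ∧ e ∈ J :=
  h e W he (tight_comp.2 (hφ.symm ▸ hW)) (by rwa [cut_comp, hφ])

/-- Contraction of an edge of weight at least one. -/
theorem hasTightJoins_of_one_le (hy : Feasible a b T y) {e₁ : E} (hne : a e₁ ≠ b e₁)
    (h1 : 1 ≤ y e₁)
    (ih : ∀ φ : V → V, φ (a e₁) = φ (b e₁) →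
      HasTightJoins (φ ∘ a) (φ ∘ b) (push φ T) y) :
    HasTightJoins a b T y := by
  intro e W he hW heW
  let φ : V → V := fun v => if v = b e₁ then a e₁ else v
  have hφ : φ (a e₁) = φ (b e₁) := by simp [φ]
  have hpre : ∀ X, e₁ ∉ cut a b X → pre φ X = X := by
    intro X hX
    ext v
    rw [mem_pre]
    by_cases hv : v = b e₁
    · rw [mem_cut, not_not] at hX
      simp [φ, hv, hX]
    · simp [φ, hv]
  obtain ⟨J', hJ', heJ'⟩ : ∃ J', IsTightJoin (φ ∘ a) (φ ∘ b) (push φ T) y J' ∧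
      (e ≠ e₁ → e ∈ J') := by
    by_cases hee : e = e₁
    · obtain ⟨J, hJ⟩ := (ih φ hφ).exists_isTightJoin (hy.comp φ)
      exact ⟨J, hJ, fun h => absurd hee h⟩
    · have hW₁ : e₁ ∉ cut a b W := fun h => hee (hW.eq_of_one_le hy h h1 heW he)
      obtain ⟨J, hJ, hJe⟩ := (ih φ hφ).exists_mem_of_pre (hpre W hW₁) he hW heW
      exact ⟨J, hJ, fun _ => hJe⟩
  -- The lifted `J'` can have wrong parity only at the ends of `e₁`; adding or removing `e₁` repairs
  -- it.
  obtain ⟨K, hK, hKT⟩ := exists_bdry_eq a b (fun v => T v + bdry a b J' v) {e₁} (by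
    intro X hX
    have hX' : e₁ ∉ cut a b X := fun h => by
      rw [inter_singleton_of_mem h] at hX; exact singleton_ne_empty _ hX
    rw [sum_add_distrib, hJ'.sum_bdry_of_pre (hpre X hX'), zmod_two_add_self])
  have hJT : bdry a b (J' ∆ K) = T := by
    funext v
    rw [bdry_symmDiff, hKT]
    linear_combination zmod_two_add_self (bdry a b J' v)
  have hmem : ∀ f, f ≠ e₁ → (f ∈ J' ∆ K ↔ f ∈ J') := by
    intro f hf
    have : f ∉ K := fun h => hf (mem_singleton.1 (hK h))
    simp [mem_symmDiff, this]
  have hsub : J' ∆ K ⊆ posEdges a b y := by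
    intro f hf
    by_cases hfe : f = e₁
    · rw [hfe, mem_posEdges]; exact ⟨by linarith, hne⟩
    · exact posEdges_comp_subset φ (hJ'.subset ((hmem f hfe).1 hf))
  have hcut : ∀ X, Tight a b T y X → e₁ ∈ cut a b X → cut a b X ∩ (J' ∆ K) = {e₁} := by
    intro X hX hX₁
    -- In a tight cut through `e₁` no other edge is positive, and parity excludes an empty
    -- intersection.
    have hs : cut a b X ∩ (J' ∆ K) ⊆ {e₁} := by
      intro f hf
      rw [mem_inter] at hf
      exact mem_singleton.2 (hX.eq_of_one_le hy hX₁ h1 hf.1 (mem_posEdges.1 (hsub hf.2)).1)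
    rcases subset_singleton_iff.1 hs with h | h
    · have h2 := card_cut_inter a b (J' ∆ K) X
      rw [h, hJT] at h2
      exact absurd h2.symm (by simpa using hX.1)
    · exact h
  refine ⟨J' ∆ K, ⟨hsub, hJT, fun X hX => ?_⟩, ?_⟩
  · by_cases hX₁ : e₁ ∈ cut a b X
    · rw [hcut X hX hX₁, card_singleton]
    · rw [← hJ'.card_eq_of_pre (hpre X hX₁) hX]
      congr 1
      ext f
      rw [mem_inter, mem_inter]
      exact and_congr_right fun hf => hmem f fun h => hX₁ (h ▸ hf)
  · by_cases hee : e = e₁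
    · have := hcut W hW (hee ▸ heW)
      rw [hee]
      exact (mem_inter.1 (this.symm ▸ mem_singleton_self e₁ : e₁ ∈ cut a b W ∩ (J' ∆ K))).2
    · exact (hmem e hee).2 (heJ' hee)

/-! ### Uncrossing -/

/-- The edges between `W \ X` and `X \ W`. -/
def crossEdges (a b : E → V) (W X : Finset V) : Finset E :=
  univ.filter fun e => (a e ∈ W \ X ∧ b e ∈ X \ W) ∨ (b e ∈ W \ X ∧ a e ∈ X \ W)

/-- Submodularity of the cut function with its exact defect, the edges between the two differences.
-/
theorem sum_cut_add_sum_cut (a b : E → V) (z : E → ℝ) (W X : Finset V) :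
    ∑ e ∈ cut a b W, z e + ∑ e ∈ cut a b X, z e =
      ∑ e ∈ cut a b (W ∩ X), z e + ∑ e ∈ cut a b (W ∪ X), z e +
        2 * ∑ e ∈ crossEdges a b W X, z e := by
  unfold cut crossEdges
  simp only [sum_filter, mul_sum, ← sum_add_distrib]
  refine sum_congr rfl fun e _ => ?_
  by_cases h1 : a e ∈ W <;> by_cases h2 : b e ∈ W <;> by_cases h3 : a e ∈ X <;>
    by_cases h4 : b e ∈ X <;> simp [h1, h2, h3, h4] <;> ring

/-- The union is odd as well, so intersection and union carry at least 1 + 1, while `W` and `X`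
carry exactly 2; equality kills the cross edges. -/
theorem Tight.uncross (hy : Feasible a b T y) {W X : Finset V} (hW : Tight a b T y W)
    (hX : Tight a b T y X) (h : ∑ v ∈ W ∩ X, T v ≠ 0) :
    Tight a b T y (W ∩ X) ∧ Tight a b T y (W ∪ X) ∧ ∀ e ∈ crossEdges a b W X, y e = 0 := by
  have h1 : ∑ v ∈ W ∪ X, T v ≠ 0 := by
    have h2 := sum_union_inter (s₁ := W) (s₂ := X) (f := T)
    rw [zmod_two_eq_one hW.1, zmod_two_eq_one hX.1, zmod_two_eq_one h] at h2
    intro h0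
    rw [h0] at h2
    revert h2; decide
  have h2 := sum_cut_add_sum_cut a b y W X
  have h3 := hy.one_le _ h
  have h4 := hy.one_le _ h1
  have h5 : 0 ≤ ∑ e ∈ crossEdges a b W X, y e := sum_nonneg fun e _ => hy.nonneg e
  rw [hW.2, hX.2] at h2
  exact ⟨⟨h, by linarith⟩, ⟨h1, by linarith⟩,
    (sum_eq_zero_iff_of_nonneg fun e _ => hy.nonneg e).1 (by linarith)⟩

theorem Tight.odd_inter_compl {W : Finset V} (hW : Tight a b T y W) {X : Finset V}
    (h : ∑ v ∈ W ∩ X, T v = 0) : ∑ v ∈ W ∩ Xᶜ, T v ≠ 0 := by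
  have h1 := sum_inter_add_sum_sdiff W X T
  rw [h, zero_add, sdiff_eq_inter_compl] at h1
  rw [h1]; exact hW.1

theorem card_cut_eq_one_of_uncross (hy : Feasible a b T y) {J : Finset E}
    (hJ : J ⊆ posEdges a b y) {W X : Finset V} (hW : Tight a b T y W) (hX : Tight a b T y X)
    (h : ∑ v ∈ W ∩ X, T v ≠ 0) (h1 : (cut a b X ∩ J).card = 1)
    (h2 : (cut a b (W ∩ X) ∩ J).card = 1) (h3 : (cut a b (W ∪ X) ∩ J).card = 1) :
    (cut a b W ∩ J).card = 1 := by
  have key := sum_cut_add_sum_cut a b (fun e => if e ∈ J then (1 : ℝ) else 0) W X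
  have h4 : ∑ e ∈ crossEdges a b W X, (if e ∈ J then (1 : ℝ) else 0) = 0 := by
    refine sum_eq_zero fun e he => if_neg fun heJ => ?_
    have := (mem_posEdges.1 (hJ heJ)).1
    rw [(hW.uncross hy hX h).2.2 e he] at this
    exact lt_irrefl _ this
  rw [h4] at key
  simp only [sum_boole, filter_mem_eq_inter, h1, h2, h3] at key
  have : ((cut a b W ∩ J).card : ℝ) = 1 := by push_cast at key; linarith
  exact_mod_cast this

/-- The map that contracts `X` to `x`. -/
def collapse (X : Finset V) (x : V) (v : V) : V := if v ∈ X then x else v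

theorem pre_collapse {X W : Finset V} {x : V} (hx : x ∈ X) (h : X ⊆ W ∨ W ⊆ Xᶜ) :
    pre (collapse X x) W = W := by
  ext v
  rw [mem_pre, collapse]
  split_ifs with hv
  · rcases h with h | h
    · exact iff_of_true (h hx) (h hv)
    · exact iff_of_false (fun hW => mem_compl.1 (h hW) hx) (fun hW => mem_compl.1 (h hW) hv)
  · rfl

/-- Gluing: a tight join with `Xᶜ` contracted uses one edge `f` of the cut of `X`. A tight join with
`X` contracted is then chosen through the same `f`, and the two fit together. -/
theorem exists_tightJoin_of_contractions (hy : Feasible a b T y) {X : Finset V}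
    (hX : Tight a b T y X)
    (h1 : ∀ x ∈ X, HasTightJoins (collapse X x ∘ a) (collapse X x ∘ b) (push (collapse X x) T) y)
    (h2 : ∀ x ∈ Xᶜ,
      HasTightJoins (collapse Xᶜ x ∘ a) (collapse Xᶜ x ∘ b) (push (collapse Xᶜ x) T) y)
    {e : E} (heX : a e ∈ X ∨ b e ∈ X) {W : Finset V} (he : 0 < y e) (hW : Tight a b T y W)
    (heW : e ∈ cut a b W) :
    ∃ J, IsTightJoin a b T y J ∧ e ∈ J := by
  obtain ⟨x₁, hx₁, -⟩ := exists_ne_zero_of_sum_ne_zero hX.1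
  obtain ⟨x₂, hx₂, -⟩ := exists_ne_zero_of_sum_ne_zero (hX.compl hy).1
  -- `W` may be split by the contraction of `Xᶜ`; uncrossing it with `X` or `Xᶜ` gives a tight cut
  -- through `e` that survives.
  obtain ⟨W', hW', heW', hsat⟩ : ∃ W', Tight a b T y W' ∧ e ∈ cut a b W' ∧
      (Xᶜ ⊆ W' ∨ W' ⊆ Xᶜᶜ) := by
    by_cases heX' : e ∈ cut a b X
    · exact ⟨X, hX, heX', Or.inr (by rw [compl_compl])⟩
    have hab : a e ∈ X ∧ b e ∈ X := by rw [mem_cut] at heX'; tauto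
    by_cases h : ∑ v ∈ W ∩ X, T v = 0
    · refine ⟨W ∪ Xᶜ, (hW.uncross hy (hX.compl hy) (hW.odd_inter_compl h)).2.1, ?_,
        Or.inl subset_union_right⟩
      rw [mem_cut] at heW ⊢
      simpa [hab.1, hab.2] using heW
    · refine ⟨W ∩ X, (hW.uncross hy hX h).1, ?_,
        Or.inr (by rw [compl_compl]; exact inter_subset_right)⟩
      rw [mem_cut] at heW ⊢
      simpa [hab.1, hab.2] using heW
  obtain ⟨J₂, hJ₂, heJ₂⟩ := (h2 x₂ hx₂).exists_mem_of_pre (pre_collapse hx₂ hsat) he hW' heW'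
  have hsat₂ : ∀ Y, Y ⊆ X → pre (collapse Xᶜ x₂) Y = Y := fun Y hY =>
    pre_collapse hx₂ (Or.inr (by rwa [compl_compl]))
  have hsat₁ : ∀ Y, Y ⊆ Xᶜ → pre (collapse X x₁) Y = Y := fun Y hY =>
    pre_collapse hx₁ (Or.inr hY)
  have hsatX : pre (collapse X x₁) X = X := pre_collapse hx₁ (Or.inl subset_rfl)
  obtain ⟨f, hf⟩ := card_eq_one.1 (hJ₂.card_eq_of_pre (hsat₂ X subset_rfl) hX)
  have hf' : f ∈ cut a b X ∩ J₂ := hf ▸ mem_singleton_self f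
  rw [mem_inter] at hf'
  have hfpos : 0 < y f := (mem_posEdges.1 (hJ₂.subset hf'.2)).1
  obtain ⟨J₁, hJ₁, hfJ₁⟩ := (h1 x₁ hx₁).exists_mem_of_pre hsatX hfpos hX hf'.1
  have hf₁ : cut a b X ∩ J₁ = {f} := by
    obtain ⟨g, hg⟩ := card_eq_one.1 (hJ₁.card_eq_of_pre hsatX hX)
    have : f ∈ cut a b X ∩ J₁ := mem_inter.2 ⟨hf'.1, hfJ₁⟩
    rw [hg, mem_singleton] at this
    rw [hg, this]
  have hkey : ∀ g ∈ cut a b X, (g ∈ J₂ ↔ g ∈ J₁) := by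
    intro g hg
    have h3 : g ∈ cut a b X ∩ J₂ ↔ g ∈ cut a b X ∩ J₁ := by rw [hf, hf₁]
    simpa [mem_inter, hg] using h3
  -- Edges touching `X` follow `J₂`, the others `J₁`; on the cut of `X` both are `{f}`.
  let J : Finset E := univ.filter fun g =>
    ((a g ∈ X ∨ b g ∈ X) ∧ g ∈ J₂) ∨ (¬ (a g ∈ X ∨ b g ∈ X) ∧ g ∈ J₁)
  have hmem : ∀ g, g ∈ J ↔
      ((a g ∈ X ∨ b g ∈ X) ∧ g ∈ J₂) ∨ (¬ (a g ∈ X ∨ b g ∈ X) ∧ g ∈ J₁) := by simp [J]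
  have hcut₂ : ∀ Y, Y ⊆ X → cut a b Y ∩ J = cut a b Y ∩ J₂ := by
    intro Y hY
    ext g
    rw [mem_inter, mem_inter, hmem]
    refine and_congr_right fun hg => ?_
    have : a g ∈ X ∨ b g ∈ X := by
      rw [mem_cut] at hg
      by_cases h : a g ∈ Y
      · exact Or.inl (hY h)
      · exact Or.inr (hY (by tauto))
    tauto
  have hcut₁ : ∀ Y, Y ⊆ Xᶜ → cut a b Y ∩ J = cut a b Y ∩ J₁ := by
    intro Y hY
    ext g
    rw [mem_inter, mem_inter, hmem]
    refine and_congr_right fun hg => ?_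
    have h3 : ¬ (a g ∈ X ∧ b g ∈ X) := by
      rw [mem_cut] at hg
      rintro ⟨h4, h5⟩
      have h6 : a g ∉ Y := fun h => mem_compl.1 (hY h) h4
      have h7 : b g ∉ Y := fun h => mem_compl.1 (hY h) h5
      tauto
    have h8 := hkey g
    rw [mem_cut] at h8
    tauto
  have hsub : J ⊆ posEdges a b y := by
    intro g hg
    rcases (hmem g).1 hg with h | h
    · exact posEdges_comp_subset _ (hJ₂.subset h.2)
    · exact posEdges_comp_subset _ (hJ₁.subset h.2)
  have hcard₂ : ∀ Y, Y ⊆ X → Tight a b T y Y → (cut a b Y ∩ J).card = 1 := fun Y hY hYt => by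
    rw [hcut₂ Y hY]; exact hJ₂.card_eq_of_pre (hsat₂ Y hY) hYt
  have hcard₁ : ∀ Y, Y ⊆ Xᶜ → Tight a b T y Y → (cut a b Y ∩ J).card = 1 := fun Y hY hYt => by
    rw [hcut₁ Y hY]; exact hJ₁.card_eq_of_pre (hsat₁ Y hY) hYt
  refine ⟨J, ⟨hsub, ?_, fun Y hY => ?_⟩, (hmem e).2 (Or.inl ⟨heX, heJ₂⟩)⟩
  · funext v
    rw [← card_star_inter]
    by_cases hv : v ∈ X
    · have hv' := singleton_subset_iff.2 hv
      have := hJ₂.sum_bdry_of_pre (hsat₂ _ hv')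
      rw [sum_singleton, sum_singleton] at this
      rw [hcut₂ _ hv', card_star_inter, this]
    · have hv' := singleton_subset_iff.2 (mem_compl.2 hv)
      have := hJ₁.sum_bdry_of_pre (hsat₁ _ hv')
      rw [sum_singleton, sum_singleton] at this
      rw [hcut₁ _ hv', card_star_inter, this]
  -- A tight `Y` crossing `X` is uncrossed with `X` or `Xᶜ`; each resulting cut has a shore inside
  -- one side, where the count is known.
  · by_cases h : ∑ v ∈ Y ∩ X, T v = 0
    · have h' := hY.odd_inter_compl h
      obtain ⟨h3, h4, -⟩ := hY.uncross hy (hX.compl hy) h'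
      refine card_cut_eq_one_of_uncross hy hsub hY (hX.compl hy) h'
        (hcard₁ _ subset_rfl (hX.compl hy)) (hcard₁ _ inter_subset_right h3) ?_
      rw [← cut_compl]
      refine hcard₂ _ ?_ (h4.compl hy)
      rw [compl_union, compl_compl]; exact inter_subset_right
    · obtain ⟨h3, h4, -⟩ := hY.uncross hy hX h
      refine card_cut_eq_one_of_uncross hy hsub hY hX h
        (hcard₂ _ subset_rfl hX) (hcard₂ _ inter_subset_right h3) ?_
      rw [← cut_compl]
      refine hcard₁ _ ?_ (h4.compl hy)
      rw [compl_union]; exact inter_subset_right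

/-- Contraction of the two sides of a tight cut. -/
theorem hasTightJoins_of_contractions (hy : Feasible a b T y) {X : Finset V}
    (hX : Tight a b T y X)
    (h1 : ∀ x ∈ X, HasTightJoins (collapse X x ∘ a) (collapse X x ∘ b) (push (collapse X x) T) y)
    (h2 : ∀ x ∈ Xᶜ,
      HasTightJoins (collapse Xᶜ x ∘ a) (collapse Xᶜ x ∘ b) (push (collapse Xᶜ x) T) y) :
    HasTightJoins a b T y := by
  intro e W he hW heW
  by_cases heX : a e ∈ X ∨ b e ∈ X
  · exact exists_tightJoin_of_contractions hy hX h1 h2 heX he hW heW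
  · refine exists_tightJoin_of_contractions hy (hX.compl hy) h2 ?_ ?_ he hW heW
    · rwa [compl_compl]
    · rw [mem_compl, mem_compl]; tauto

/-! ### Moving a point of the polyhedron -/

/-- Ratio test: `t` is the least of the ratios `p i / (-q i)` over the decreasing coordinates. -/
theorem exists_first_zero {ι : Type*} [Finite ι] (p q : ι → ℝ) (hp : ∀ i, 0 ≤ p i)
    (hq : ∃ i, q i < 0) :
    ∃ t, 0 ≤ t ∧ (∀ i, 0 ≤ p i + t * q i) ∧ ∃ i, q i < 0 ∧ p i + t * q i = 0 := by
  classical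
  have := Fintype.ofFinite ι
  obtain ⟨i, hi, hmin⟩ := exists_min_image (univ.filter fun i => q i < 0)
    (fun i => p i / (-q i)) (by obtain ⟨i, hi⟩ := hq; exact ⟨i, by simpa using hi⟩)
  simp only [mem_filter, mem_univ, true_and] at hi hmin
  have hi' : 0 < -q i := by linarith
  refine ⟨p i / (-q i), div_nonneg (hp i) hi'.le, fun j => ?_, i, hi, by
    rw [div_neg, neg_mul, div_mul_cancel₀ _ hi.ne, add_neg_cancel]⟩
  by_cases hj : q j < 0
  · have h1 := hmin j hj
    rw [le_div_iff₀ (by linarith)] at h1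
    linarith
  · have := mul_nonneg (div_nonneg (hp i) hi'.le) (not_lt.1 hj)
    linarith [hp j]

/-- Move along `d` until the first inequality becomes tight. The conditions on `d` preserve zero
coordinates and tight cuts, so the inequality reached was strict and slackness drops. -/
theorem Feasible.exists_move (hy : Feasible a b T y) {d : E → ℝ}
    (hdneg : ∀ e, d e < 0 → e ∈ posEdges a b y) (hd0 : ∀ e, y e = 0 → d e = 0)
    (hdT : ∀ W, Tight a b T y W → ∑ e ∈ cut a b W, d e = 0) (hneg : ∃ e, d e < 0) :
    ∃ t, 0 ≤ t ∧ Feasible a b T (fun e => y e + t * d e) ∧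
      slackness a b T (fun e => y e + t * d e) < slackness a b T y ∧
      posEdges a b (fun e => y e + t * d e) ⊆ posEdges a b y ∧
      ∀ W, Tight a b T y W → Tight a b T (fun e => y e + t * d e) W := by
  let ι := E ⊕ {W : Finset V // ∑ v ∈ W, T v ≠ 0}
  obtain ⟨t, ht, hall, i, hi, hi0⟩ := exists_first_zero (ι := ι)
    (Sum.elim y fun W => ∑ e ∈ cut a b W.1, y e - 1)
    (Sum.elim d fun W => ∑ e ∈ cut a b W.1, d e)
    (by
      rintro (e | W)
      · exact hy.nonneg e
      · exact sub_nonneg.2 (hy.one_le _ W.2))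
    (by obtain ⟨e, he⟩ := hneg; exact ⟨Sum.inl e, he⟩)
  have hsum : ∀ W, ∑ e ∈ cut a b W, (y e + t * d e) =
      ∑ e ∈ cut a b W, y e + t * ∑ e ∈ cut a b W, d e := fun W => by
    rw [sum_add_distrib, mul_sum]
  have hfeas : Feasible a b T (fun e => y e + t * d e) :=
    ⟨fun e => hall (Sum.inl e), fun W hW => by
      rw [hsum]
      have := hall (Sum.inr ⟨W, hW⟩)
      simp only [Sum.elim_inr] at this
      linarith⟩
  have htight : ∀ W, Tight a b T y W → Tight a b T (fun e => y e + t * d e) W := fun W hW =>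
    ⟨hW.1, by rw [hsum, hW.2, hdT W hW, mul_zero, add_zero]⟩
  have hpos : posEdges a b (fun e => y e + t * d e) ⊆ posEdges a b y := by
    intro e he
    rw [mem_posEdges] at he ⊢
    refine ⟨lt_of_le_of_ne (hy.nonneg e) fun h => ?_, he.2⟩
    have h1 := he.1
    rw [← h, hd0 e h.symm] at h1
    simp at h1
  have hloose : looseCuts a b T (fun e => y e + t * d e) ⊆ looseCuts a b T y := by
    refine image_subset_image fun W hW => ?_
    simp only [mem_filter, mem_univ, true_and] at hW ⊢
    exact ⟨hW.1, fun h => hW.2 (htight W ⟨hW.1, h⟩).2⟩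
  refine ⟨t, ht, hfeas, ?_, hpos, htight⟩
  rcases i with e | ⟨W, hW⟩
  · refine add_lt_add_of_lt_of_le (card_lt_card ?_) (card_le_card hloose)
    refine Finset.ssubset_iff_subset_ne.2 ⟨hpos, fun h => ?_⟩
    have h1 := hdneg e hi
    rw [← h, mem_posEdges] at h1
    simp only [Sum.elim_inl] at hi0
    linarith [h1.1]
  · simp only [Sum.elim_inr] at hi hi0
    refine add_lt_add_of_le_of_lt (card_le_card hpos) (card_lt_card ?_)
    refine Finset.ssubset_iff_subset_ne.2 ⟨hloose, fun h => ?_⟩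
    have h1 : cut a b W ∈ looseCuts a b T y := by
      refine mem_image_of_mem _ (mem_filter.2 ⟨mem_univ _, hW, fun h1 => ?_⟩)
      have := hdT W ⟨hW, h1⟩
      linarith
    rw [← h] at h1
    simp only [looseCuts, mem_image, mem_filter, mem_univ, true_and] at h1
    obtain ⟨W', ⟨-, h2⟩, h3⟩ := h1
    rw [h3, hsum] at h2
    exact h2 (by linarith)

theorem IsTightJoin.mono {y' : E → ℝ} {J : Finset E} (hJ : IsTightJoin a b T y' J)
    (hpos : posEdges a b y' ⊆ posEdges a b y)
    (htight : ∀ W, Tight a b T y W → Tight a b T y' W) : IsTightJoin a b T y J :=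
  ⟨hJ.subset.trans hpos, hJ.bdry_eq, fun W hW => hJ.card_eq W (htight W hW)⟩

/-! ### All tight cuts are stars -/

/-- With no positive edge inside `W`, the positive edges at an odd `t ∈ W` all cross `W`. They
already weigh at least 1, the full weight of the cut, so nothing else remains. -/
theorem Tight.exists_star (hy : Feasible a b T y) {W : Finset V} (hW : Tight a b T y W)
    (h : ∀ e ∈ posEdges a b y, ¬ (a e ∈ W ∧ b e ∈ W)) :
    ∃ t, Tight a b T y {t} ∧ ∀ e, 0 < y e → (e ∈ cut a b W ↔ e ∈ cut a b {t}) := by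
  obtain ⟨t, ht, hTt⟩ := exists_ne_zero_of_sum_ne_zero hW.1
  have hTt' : ∑ v ∈ {t}, T v ≠ 0 := by rwa [sum_singleton]
  have hsub : ∀ e, 0 < y e → e ∈ cut a b {t} → e ∈ cut a b W := by
    intro e he het
    have h1 := h e (mem_posEdges_of_mem_cut he het)
    rw [mem_cut, mem_singleton, mem_singleton] at het
    rw [mem_cut]
    by_cases h2 : a e = t
    · rw [← h2] at ht; tauto
    · have h3 : b e = t := by tauto
      rw [← h3] at ht; tauto
  have hsplit : ∑ e ∈ cut a b {t}, y e + ∑ e ∈ cut a b W \ cut a b {t}, y e ≤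
      ∑ e ∈ cut a b W, y e := by
    rw [← sum_inter_add_sum_sdiff (cut a b W) (cut a b {t})]
    refine add_le_add_left (le_of_eq ?_) _
    refine (sum_subset inter_subset_right fun e he hne => ?_).symm
    refine le_antisymm (not_lt.1 fun hpos => hne (mem_inter.2 ⟨hsub e hpos he, he⟩)) (hy.nonneg e)
  have h1 := hy.one_le _ hTt'
  have h0 : 0 ≤ ∑ e ∈ cut a b W \ cut a b {t}, y e := sum_nonneg fun e _ => hy.nonneg e
  rw [hW.2] at hsplit
  refine ⟨t, ⟨hTt', by linarith⟩, fun e he => ⟨fun heW => ?_, hsub e he⟩⟩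
  by_contra het
  have h2 := (sum_eq_zero_iff_of_nonneg fun e _ => hy.nonneg e).1
    (le_antisymm (by linarith) h0) e (mem_sdiff.2 ⟨heW, het⟩)
  linarith

/-- Fewer star equations than unknowns supported on `F`. -/
theorem exists_kernel_vector (a b : E → V) {A : Finset V} {F : Finset E} (h : A.card < F.card) :
    ∃ z : E → ℝ, z ≠ 0 ∧ (∀ e, z e ≠ 0 → e ∈ F) ∧ ∀ v ∈ A, ∑ e ∈ cut a b {v}, z e = 0 := by
  let L : (E → ℝ) →ₗ[ℝ] (A → ℝ) × ((Fᶜ : Finset E) → ℝ) :=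
    LinearMap.prod
      (LinearMap.pi fun v => ∑ e ∈ cut a b {(v : V)}, LinearMap.proj e)
      (LinearMap.pi fun e => LinearMap.proj (e : E))
  have hL : LinearMap.ker L ≠ ⊥ := by
    refine LinearMap.ker_ne_bot_of_finrank_lt ?_
    rw [Module.finrank_prod, Module.finrank_fintype_fun_eq_card,
      Module.finrank_fintype_fun_eq_card, Module.finrank_fintype_fun_eq_card,
      Fintype.card_coe, Fintype.card_coe, card_compl]
    have := card_le_univ F
    omega
  obtain ⟨z, hz, hz0⟩ := Submodule.exists_mem_ne_zero_of_ne_bot hL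
  rw [LinearMap.mem_ker, Prod.ext_iff] at hz
  refine ⟨z, hz0, fun e he => ?_, fun v hv => ?_⟩
  · by_contra heF
    exact he (congrFun hz.2 ⟨e, mem_compl.2 heF⟩)
  · have := congrFun hz.1 ⟨v, hv⟩
    simpa [L] using this

theorem sum_card_star_inter (a b : E → V) {F : Finset E} (hF : ∀ e ∈ F, a e ≠ b e) :
    ∑ v, (cut a b {v} ∩ F).card = 2 * F.card := by
  have h1 : ∀ v, (cut a b {v} ∩ F).card = ∑ e ∈ F, if e ∈ cut a b {v} then 1 else 0 := by
    intro v
    rw [inter_comm, ← filter_mem_eq_inter, card_filter]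
  simp only [h1]
  rw [sum_comm, mul_comm, ← smul_eq_mul, ← sum_const]
  refine sum_congr rfl fun e he => ?_
  rw [← card_filter, ← card_pair (hF e he)]
  congr 1
  ext v
  have := hF e he
  simp only [mem_filter, mem_univ, true_and, mem_cut, mem_singleton, mem_insert]
  constructor
  · intro h; by_contra h'; apply h; constructor <;> intro h2 <;> exact absurd h2.symm (by tauto)
  · rintro (rfl | rfl)
    · simpa using this.symm
    · simpa using this

theorem two_le_card_star (hy : Feasible a b T y) (hlt : ∀ e ∈ posEdges a b y, y e < 1) {v : V}
    (hv : Tight a b T y {v}) : 2 ≤ (cut a b {v} ∩ posEdges a b y).card := by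
  have h1 : ∑ e ∈ cut a b {v} ∩ posEdges a b y, y e = 1 := by
    rw [← hv.2]
    refine sum_subset inter_subset_left fun e he hne => ?_
    refine le_antisymm (not_lt.1 fun hpos => hne (mem_inter.2 ⟨he, ?_⟩)) (hy.nonneg e)
    exact mem_posEdges_of_mem_cut hpos he
  by_contra h2
  have h3 : (cut a b {v} ∩ posEdges a b y).card ≤ 1 := by omega
  by_cases h0 : cut a b {v} ∩ posEdges a b y = ∅
  · rw [h0] at h1; simp at h1
  · obtain ⟨e, he⟩ := card_eq_one.1
      (le_antisymm h3 (card_pos.2 (nonempty_iff_ne_empty.2 h0)))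
    have h4 : e ∈ cut a b {v} ∩ posEdges a b y := he ▸ mem_singleton_self e
    rw [he, sum_singleton] at h1
    linarith [hlt e (mem_inter.1 h4).2]

/-- The case in which every tight cut is a star and the positive edges form disjoint cycles. -/
theorem exists_tightJoin_of_two_regular (hy : Feasible a b T y)
    (hstar : ∀ W, Tight a b T y W →
      ∃ t, Tight a b T y {t} ∧ ∀ e, 0 < y e → (e ∈ cut a b W ↔ e ∈ cut a b {t}))
    (htwo : ∀ v, Tight a b T y {v} → (cut a b {v} ∩ posEdges a b y).card = 2)
    (hzero : ∀ v, ¬ Tight a b T y {v} → (cut a b {v} ∩ posEdges a b y).card = 0)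
    {e : E} (he : e ∈ posEdges a b y) :
    ∃ J, IsTightJoin a b T y J ∧ e ∈ J := by
  -- At a tight star two positive edges are available and the parity is odd, so every `T`-join of
  -- positive edges uses exactly one.
  have hgood : ∀ K ⊆ posEdges a b y, bdry a b K = T → IsTightJoin a b T y K := by
    intro K hK hKT
    refine ⟨hK, hKT, fun W hW => ?_⟩
    obtain ⟨t, ht, hiff⟩ := hstar W hW
    have h1 : cut a b W ∩ K = cut a b {t} ∩ K := by
      ext f
      rw [mem_inter, mem_inter]
      exact and_congr_left fun hf => hiff f (mem_posEdges.1 (hK hf)).1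
    have h2 : (cut a b {t} ∩ K).card ≤ 2 := by
      rw [← htwo t ht]; exact card_le_card (inter_subset_inter_left hK)
    have h3 := card_star_inter a b K t
    have h4 := ht.1
    rw [sum_singleton] at h4
    rw [hKT, zmod_two_eq_one h4] at h3
    rw [h1]
    interval_cases h5 : (cut a b {t} ∩ K).card
    · exact absurd h3 (by decide)
    · rfl
    · exact absurd h3 (by decide)
  obtain ⟨J, hJ, hJT⟩ := hy.exists_join
  by_cases heJ : e ∈ J
  · exact ⟨J, hgood J hJ hJT, heJ⟩
  -- All degrees of the support are even, so the complement of `J` in it is again a `T`-join, and it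
  -- contains `e`.
  · refine ⟨posEdges a b y ∆ J, hgood _ ?_ ?_, ?_⟩
    · exact union_subset sdiff_subset (sdiff_subset.trans hJ)
    · funext v
      have h0 : bdry a b (posEdges a b y) v = 0 := by
        rw [← card_star_inter]
        by_cases hv : Tight a b T y {v}
        · rw [htwo v hv]; decide
        · rw [hzero v hv]; simp
      rw [bdry_symmDiff, h0, zero_add, hJT]
    · exact mem_symmDiff.2 (Or.inl ⟨he, heJ⟩)

theorem hasTightJoins_of_stars (hy : Feasible a b T y)
    (hstar : ∀ W, Tight a b T y W →
      ∃ t, Tight a b T y {t} ∧ ∀ e, 0 < y e → (e ∈ cut a b W ↔ e ∈ cut a b {t}))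
    (hlt : ∀ e ∈ posEdges a b y, y e < 1)
    (ih : ∀ y', Feasible a b T y' → slackness a b T y' < slackness a b T y →
      HasTightJoins a b T y') :
    HasTightJoins a b T y := by
  classical
  intro e W he hW heW
  -- Any admissible direction with `0 ≤ d e` keeps `e` positive, so the induction hypothesis at the
  -- moved point finishes.
  have hmove : ∀ d : E → ℝ, (∀ f, d f ≠ 0 → f ∈ posEdges a b y) →
      (∀ v, Tight a b T y {v} → ∑ f ∈ cut a b {v}, d f = 0) → 0 ≤ d e → (∃ f, d f < 0) →
      ∃ J, IsTightJoin a b T y J ∧ e ∈ J := by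
    intro d hd hdT hde hneg
    have hdT' : ∀ X, Tight a b T y X → ∑ f ∈ cut a b X, d f = 0 := by
      intro X hX
      obtain ⟨t, ht, hiff⟩ := hstar X hX
      rw [← hdT t ht, cut, cut, sum_filter, sum_filter]
      refine sum_congr rfl fun f _ => ?_
      by_cases hf : d f = 0
      · simp [hf]
      · have := hiff f (mem_posEdges.1 (hd f hf)).1
        rw [mem_cut, mem_cut] at this
        simp only [this]
    obtain ⟨t, ht, hfeas, hslack, hpos, htight⟩ := hy.exists_move
      (fun f hf => hd f hf.ne)
      (fun f hf => by
        by_contra h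
        exact (mem_posEdges.1 (hd f h)).1.ne' hf) hdT' hneg
    obtain ⟨J, hJ, heJ⟩ := ih _ hfeas hslack e W
      (add_pos_of_pos_of_nonneg he (mul_nonneg ht hde)) (htight W hW) heW
    exact ⟨J, hJ.mono hpos htight, heJ⟩
  by_cases hcover : ∃ f ∈ posEdges a b y, ∀ v, Tight a b T y {v} → f ∉ cut a b {v}
  · obtain ⟨f, hf, hfv⟩ := hcover
    -- An edge in no tight star can be lowered on its own.
    refine hmove (Pi.single f (-1)) (fun g hg => ?_) (fun v hv => ?_) ?_ ⟨f, by simp⟩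
    · by_cases hgf : g = f
      · rwa [hgf]
      · exact absurd (Pi.single_eq_of_ne hgf _) hg
    · refine sum_eq_zero fun g hg => Pi.single_eq_of_ne ?_ _
      rintro rfl
      exact hfv v hv hg
    · obtain ⟨t, ht, hiff⟩ := hstar W hW
      have hef : e ≠ f := fun h => hfv t ht (h ▸ (hiff e he).1 heW)
      rw [Pi.single_eq_of_ne hef]
  push Not at hcover
  set A : Finset V := univ.filter fun v => Tight a b T y {v} with hA
  have hmemA : ∀ v, v ∈ A ↔ Tight a b T y {v} := by simp [hA]
  by_cases hcard : A.card < (posEdges a b y).card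
  · obtain ⟨z, hz0, hzF, hzA⟩ := exists_kernel_vector a b hcard
    -- A nonnegative vector with zero sum on each tight star vanishes, since these stars cover the
    -- support. So both `z` and `-z` have a negative entry, and the sign is free to be chosen at
    -- `e`.
    have hneg : ∀ d : E → ℝ, d ≠ 0 → (∀ f, d f ≠ 0 → f ∈ posEdges a b y) →
        (∀ v ∈ A, ∑ f ∈ cut a b {v}, d f = 0) → ∃ f, d f < 0 := by
      intro d hd hdF hdA
      by_contra! hnn
      obtain ⟨f, hf⟩ := Function.ne_iff.1 hd
      obtain ⟨v, hv, hfv⟩ := hcover f (hdF f hf)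
      exact hf ((sum_eq_zero_iff_of_nonneg fun g _ => hnn g).1
        (hdA v ((hmemA v).2 hv)) f hfv)
    rcases le_total 0 (z e) with h | h
    · exact hmove z hzF (fun v hv => hzA v ((hmemA v).2 hv)) h (hneg z hz0 hzF hzA)
    · have h1 : ∀ f, (-z) f ≠ 0 → f ∈ posEdges a b y := fun f hf => hzF f (by simpa using hf)
      have h2 : ∀ v ∈ A, ∑ f ∈ cut a b {v}, (-z) f = 0 := fun v hv => by
        simp [hzA v hv]
      exact hmove (-z) h1 (fun v hv => h2 v ((hmemA v).2 hv)) (by simpa using h)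
        (hneg _ (neg_ne_zero.2 hz0) h1 h2)
  -- Tight stars have degree at least 2 and the total degree is 2|support| ≤ 2|A|; hence equality,
  -- with degree 0 outside `A`.
  · have hdeg := sum_card_star_inter a b (F := posEdges a b y)
      (fun f hf => (mem_posEdges.1 hf).2)
    rw [← sum_add_sum_compl A] at hdeg
    have h2 : ∀ v ∈ A, 2 ≤ (cut a b {v} ∩ posEdges a b y).card := fun v hv =>
      two_le_card_star hy hlt ((hmemA v).1 hv)
    have h3 : ∑ _v ∈ A, 2 ≤ ∑ v ∈ A, (cut a b {v} ∩ posEdges a b y).card := sum_le_sum h2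
    have h4 : ∑ _v ∈ A, 2 = A.card * 2 := by rw [sum_const, smul_eq_mul]
    have h5 : ∑ v ∈ Aᶜ, (cut a b {v} ∩ posEdges a b y).card = 0 := by omega
    have h6 := (sum_eq_sum_iff_of_le h2).1 (by omega)
    refine exists_tightJoin_of_two_regular hy hstar
      (fun v hv => (h6 v ((hmemA v).2 hv)).symm)
      (fun v hv => sum_eq_zero_iff.1 h5 v (mem_compl.2 fun h => hv ((hmemA v).1 h)))
      (mem_posEdges_of_mem_cut he heW)

/-! ### The `T`-join polyhedron -/

theorem Feasible.hasTightJoins (hy : Feasible a b T y) : HasTightJoins a b T y := by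
  induction hn : slackness a b T y using Nat.strong_induction_on generalizing a b T y with
  | _ n ih =>
    subst hn
    have ihφ : ∀ φ : V → V, ∀ e ∈ posEdges a b y, φ (a e) = φ (b e) →
        HasTightJoins (φ ∘ a) (φ ∘ b) (push φ T) y := fun φ e he hφ =>
      ih _ (slackness_comp_lt he hφ) (hy.comp φ) rfl
    by_cases hone : ∃ e ∈ posEdges a b y, 1 ≤ y e
    · obtain ⟨e, he, h1⟩ := hone
      exact hasTightJoins_of_one_le hy (mem_posEdges.1 he).2 h1 fun φ hφ => ihφ φ e he hφ
    push Not at hone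
    by_cases hX : ∃ X, Tight a b T y X ∧ (∃ e ∈ posEdges a b y, a e ∈ X ∧ b e ∈ X) ∧
        ∃ e ∈ posEdges a b y, a e ∈ Xᶜ ∧ b e ∈ Xᶜ
    · obtain ⟨X, hX, ⟨e, he, hea, heb⟩, f, hf, hfa, hfb⟩ := hX
      refine hasTightJoins_of_contractions hy hX (fun x _ => ihφ _ e he ?_)
        (fun x _ => ihφ _ f hf ?_)
      · simp [collapse, hea, heb]
      · simp only [collapse, hfa, hfb, if_true]
    · refine hasTightJoins_of_stars hy (fun W hW => ?_) hone fun y' hy' hlt => ih _ hlt hy' rfl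
      by_cases hin : ∃ e ∈ posEdges a b y, a e ∈ W ∧ b e ∈ W
      · obtain ⟨t, ht, hiff⟩ := (hW.compl hy).exists_star hy fun e he h =>
          hX ⟨W, hW, hin, e, he, h⟩
        exact ⟨t, ht, by simpa only [cut_compl] using hiff⟩
      · exact hW.exists_star hy fun e he h => hin ⟨e, he, h⟩

/-- A point of the `T`-join polyhedron costs at least as much as some `T`-join. -/
theorem Feasible.exists_join_le (hy : Feasible a b T y) {c : E → ℝ} (hc : ∀ e, 0 ≤ c e) :
    ∃ J, bdry a b J = T ∧ ∑ e ∈ J, c e ≤ ∑ e, c e * y e := by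
  induction hn : slackness a b T y using Nat.strong_induction_on generalizing y with
  | _ n ih =>
    subst hn
    obtain ⟨J, hJ⟩ := hy.hasTightJoins.exists_isTightJoin hy
    by_cases hcost : ∑ e ∈ J, c e ≤ ∑ e, c e * y e
    · exact ⟨J, hJ.bdry_eq, hcost⟩
    have hsumJ : ∑ e, c e * (if e ∈ J then (1 : ℝ) else 0) = ∑ e ∈ J, c e := by simp
    have hd : ∀ e, y e - (if e ∈ J then (1 : ℝ) else 0) < 0 → e ∈ J := by
      intro e he
      by_contra h
      rw [if_neg h] at he
      linarith [hy.nonneg e]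
    by_cases hneg : ∃ e, y e - (if e ∈ J then (1 : ℝ) else 0) < 0
    -- The direction `y - χ_J` vanishes on tight cuts, because both terms sum to 1 there.
    · obtain ⟨t, ht, hfeas, hslack, -, -⟩ := hy.exists_move
        (d := fun e => y e - if e ∈ J then (1 : ℝ) else 0) (fun e he => hJ.subset (hd e he))
        (fun e he => by
          have : e ∉ J := fun h => (mem_posEdges.1 (hJ.subset h)).1.ne' he
          simp [he, this])
        (fun W hW => by
          rw [sum_sub_distrib, hW.2, sum_boole, filter_mem_eq_inter, hJ.card_eq W hW]
          simp) hneg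
      obtain ⟨K, hK, hle⟩ := ih _ hslack hfeas rfl
      refine ⟨K, hK, hle.trans ?_⟩
      have h1 : ∑ e, c e * (y e + t * (y e - if e ∈ J then (1 : ℝ) else 0)) =
          ∑ e, c e * y e + t * (∑ e, c e * y e - ∑ e ∈ J, c e) := by
        rw [← hsumJ, ← sum_sub_distrib, mul_sum, ← sum_add_distrib]
        exact sum_congr rfl fun e _ => by ring
      rw [h1]
      have := mul_nonneg ht (sub_nonneg.2 (not_le.1 hcost).le)
      linarith
    · push Not at hneg
      refine absurd ?_ hcost
      rw [← hsumJ]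
      exact sum_le_sum fun e _ => mul_le_mul_of_nonneg_left (sub_nonneg.1 (hneg e)) (hc e)

end TJoin

namespace MultiGraph

open TJoin

variable {V E : Type*} [Fintype V] [DecidableEq V] [Fintype E] [DecidableEq E]
variable {G : MultiGraph V E} {a b : E → V}

/-! ### Translation between multigraphs and oriented endpoints -/

theorem exists_endpoints (G : MultiGraph V E) : ∃ a b : E → V, ∀ e, G.ends e = s(a e, b e) := by
  have h : ∀ e, ∃ p : V × V, G.ends e = s(p.1, p.2) := fun e => by
    induction G.ends e with | _ u v => exact ⟨(u, v), rfl⟩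
  choose p hp using h
  exact ⟨fun e => (p e).1, fun e => (p e).2, hp⟩

theorem delta_eq_cut (hG : ∀ e, G.ends e = s(a e, b e)) (W : Finset V) :
    G.delta W = cut a b W := by
  ext e
  simp only [delta, mem_filter, mem_univ, true_and, mem_cut, hG, Sym2.eq_iff]
  constructor
  · rintro ⟨u, hu, v, hv, ⟨h1, h2⟩ | ⟨h1, h2⟩⟩ <;> simp [h1, h2, hu, hv]
  · intro h
    by_cases h1 : a e ∈ W
    · exact ⟨a e, h1, b e, by tauto, Or.inl ⟨rfl, rfl⟩⟩
    · exact ⟨b e, by tauto, a e, h1, Or.inr ⟨rfl, rfl⟩⟩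

/-- The indicator of `T` modulo two. -/
def parity (T : Finset V) (v : V) : ZMod 2 := if v ∈ T then 1 else 0

theorem sum_parity (T W : Finset V) : ∑ v ∈ W, parity T v = ((W ∩ T).card : ℕ) := by
  simp [parity]

theorem sum_parity_eq_zero_iff (T W : Finset V) :
    ∑ v ∈ W, parity T v = 0 ↔ Even (W ∩ T).card := by
  rw [sum_parity, ZMod.natCast_eq_zero_iff_even]

theorem parity_symmDiff (S T : Finset V) (v : V) :
    parity (S ∆ T) v = parity S v + parity T v := by
  unfold parity
  by_cases h1 : v ∈ S <;> by_cases h2 : v ∈ T <;> simp [mem_symmDiff, h1, h2]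
  decide

theorem parity_oddVertices (hG : ∀ e, G.ends e = s(a e, b e)) (J : Finset E) :
    parity (G.oddVertices J) = bdry a b J := by
  funext v
  rw [← card_star_inter, parity, ← delta_eq_cut hG]
  by_cases h : Odd (G.delta {v} ∩ J).card
  · rw [if_pos (by simpa [oddVertices] using h), (ZMod.natCast_eq_one_iff_odd).2 h]
  · rw [if_neg (by simpa [oddVertices] using h), eq_comm, ZMod.natCast_eq_zero_iff_even]
    exact Nat.not_odd_iff_even.1 h

theorem parity_injective : Function.Injective (parity : Finset V → V → ZMod 2) := by
  intro S T h
  ext v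
  have := congrFun h v
  unfold parity at this
  by_cases h1 : v ∈ S <;> by_cases h2 : v ∈ T <;> simp_all

theorem isTJoin_iff (hG : ∀ e, G.ends e = s(a e, b e)) (T : Finset V) (J : Finset E) :
    G.IsTJoin T J ↔ bdry a b J = parity T := by
  rw [IsTJoin, ← parity_oddVertices hG, parity_injective.eq_iff]

theorem tau_le {T : Finset V} {J : Finset E} (hJ : G.IsTJoin T J) (c : E → ℝ) :
    G.tau T c ≤ ∑ e ∈ J, c e :=
  (G.isLeast_tau T c ⟨J, hJ⟩).2 ⟨J, hJ, rfl⟩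

theorem even_card_oddVertices (G : MultiGraph V E) (J : Finset E) :
    Even (G.oddVertices J).card := by
  obtain ⟨a, b, hG⟩ := G.exists_endpoints
  have := sum_parity_eq_zero_iff (G.oddVertices J) univ
  rw [univ_inter] at this
  rw [← this, parity_oddVertices hG, ← card_cut_inter, cut_univ]
  simp

/-! ### Spanning trees and parity correction -/

/-- A cut that contains no edge of a spanning tree is trivial. -/
theorem IsSpanningTree.eq_empty_or_univ {F : Finset E} (hF : G.IsSpanningTree F) {W : Finset V}
    (hW : G.delta W ∩ F = ∅) : W = ∅ ∨ W = univ := by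
  by_contra! h
  obtain ⟨u, hu⟩ := h.1
  obtain ⟨v, hv⟩ : ∃ v, v ∉ W := by
    by_contra! h2
    exact h.2 (eq_univ_iff_forall.2 h2)
  obtain ⟨p⟩ := hF.2.2.connected.preconnected u v
  obtain ⟨d, -, hd1, hd2⟩ := p.exists_boundary_dart (W : Set V) hu hv
  obtain ⟨⟨e, he, hee⟩, -⟩ := (SimpleGraph.fromEdgeSet_adj _).1 d.adj
  have : e ∈ G.delta W ∩ F :=
    mem_inter.2 ⟨mem_filter.2 ⟨mem_univ _, _, hd1, _, hd2, hee⟩, he⟩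
  rw [hW] at this
  exact notMem_empty _ this

theorem IsSpanningTree.treeJoin_spec {F : Finset E} (hF : G.IsSpanningTree F) {T : Finset V}
    (hT : Even T.card) : G.treeJoin T F ⊆ F ∧ G.IsTJoin T (G.treeJoin T F) := by
  obtain ⟨a, b, hG⟩ := G.exists_endpoints
  refine Classical.epsilon_spec (p := fun J => J ⊆ F ∧ G.IsTJoin T J) ?_
  obtain ⟨J, hJ, hJT⟩ := exists_bdry_eq a b (parity T) F fun W hW => by
    rw [← delta_eq_cut hG] at hW
    rw [sum_parity_eq_zero_iff]
    rcases hF.eq_empty_or_univ hW with rfl | rfl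
    · simp
    · rwa [univ_inter]
  exact ⟨J, hJ, (isTJoin_iff hG T J).2 hJT⟩

/-- Removing F(T) from F is a symmetric difference, so the boundaries add modulo two. -/
theorem IsSpanningTree.isTJoin_sdiff_treeJoin {F : Finset E} (hF : G.IsSpanningTree F)
    {T : Finset V} (hT : Even T.card) :
    G.IsTJoin (G.oddVertices F ∆ T) (F \ G.treeJoin T F) := by
  obtain ⟨a, b, hG⟩ := G.exists_endpoints
  obtain ⟨h1, h2⟩ := hF.treeJoin_spec hT
  rw [isTJoin_iff hG] at h2 ⊢
  funext v
  have h3 : F \ G.treeJoin T F = F ∆ G.treeJoin T F := (symmDiff_of_ge h1).symm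
  rw [h3, bdry_symmDiff, parity_symmDiff, h2, parity_oddVertices hG]

/-- The partition inequality for the two classes `W` and `Wᶜ`. -/
theorem one_le_sum_delta {x : E → ℝ} {T : Finset V} (hx : x ∈ G.tourPolyhedron T) {W : Finset V}
    (h0 : W ≠ ∅) (h1 : W ≠ univ) : 1 ≤ ∑ e ∈ G.delta W, x e := by
  obtain ⟨a, b, hG⟩ := G.exists_endpoints
  have h1' : Wᶜ ≠ ∅ := fun h => h1 (compl_eq_empty_iff W |>.1 h)
  have hne : W ≠ Wᶜ := fun h => by
    obtain ⟨v, hv⟩ := nonempty_iff_ne_empty.2 h0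
    exact mem_compl.1 (h ▸ hv : v ∈ Wᶜ) hv
  let P : Finpartition (univ : Finset V) :=
    { parts := {W, Wᶜ}
      supIndep := (supIndep_pair hne).2 disjoint_compl_right
      sup_parts := by simp
      bot_notMem := by
        rw [mem_insert, mem_singleton]
        rintro (h | h)
        · exact h0 h.symm
        · exact h1' h.symm }
  have h2 := hx.2.1 P
  have h3 : G.deltaPartition P = G.delta W := by
    simp [deltaPartition, P, delta_eq_cut hG, cut_compl]
  have h4 : P.parts.card = 2 := card_pair hne
  rw [h3, h4] at h2
  norm_num at h2
  exact h2

/-- The parity correction of a single spanning tree. -/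
theorem tau_le_half {x : E → ℝ} {T : Finset V} (hT : Even T.card)
    (hx : x ∈ G.tourPolyhedron T) {F : Finset E} (hF : G.IsSpanningTree F) {c : E → ℝ}
    (hc : ∀ e, 0 ≤ c e) :
    G.tau (G.oddVertices F ∆ T) c ≤
      (∑ e, c e * x e) / 2 + (∑ e ∈ G.treeJoin T F, c e) / 2 := by
  obtain ⟨a, b, hG⟩ := G.exists_endpoints
  obtain ⟨-, hJ⟩ := hF.treeJoin_spec hT
  set J := G.treeJoin T F
  have hJnn : ∀ e, (0 : ℝ) ≤ if e ∈ J then (1 : ℝ) else 0 := fun e => by split_ifs <;> norm_num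
  have hfeas : Feasible a b (parity (G.oddVertices F ∆ T))
      (fun e => x e / 2 + (if e ∈ J then (1 : ℝ) else 0) / 2) := by
    refine ⟨fun e => by linarith [(hx.2.2 e).1, hJnn e], fun W hW => ?_⟩
    have h0 : W ≠ ∅ := by rintro rfl; simp at hW
    have h1 : W ≠ univ := by
      rintro rfl
      refine hW ?_
      have h2 := (sum_parity_eq_zero_iff T univ).2 (by rwa [univ_inter])
      have h3 := (sum_parity_eq_zero_iff (G.oddVertices F) univ).2
        (by rw [univ_inter]; exact even_card_oddVertices G F)
      simp only [parity_symmDiff, sum_add_distrib, h2, h3, add_zero]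
    rw [sum_add_distrib, ← sum_div, ← sum_div, sum_boole, filter_mem_eq_inter,
      ← delta_eq_cut hG]
    by_cases hev : Even (W ∩ T).card
    · have h2 := hx.1 W h0 (ssubset_univ_iff.2 h1) hev
      have h3 : (0 : ℝ) ≤ (G.delta W ∩ J).card := Nat.cast_nonneg _
      linarith
    · have h2 := one_le_sum_delta hx h0 h1
      have h3 : (1 : ℝ) ≤ (G.delta W ∩ J).card := by
        rw [Nat.one_le_cast, Nat.one_le_iff_ne_zero]
        intro h
        rw [delta_eq_cut hG] at h
        have h4 := card_cut_inter a b J W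
        rw [h, (isTJoin_iff hG T J).1 hJ] at h4
        exact hev ((sum_parity_eq_zero_iff T W).1 (by rw [← h4]; simp))
      linarith
  obtain ⟨K, hK, hle⟩ := hfeas.exists_join_le hc
  refine (tau_le ((isTJoin_iff hG _ K).2 hK) c).trans (hle.trans (le_of_eq ?_))
  have h1 : ∑ e ∈ J, c e = ∑ e, c e * if e ∈ J then (1 : ℝ) else 0 := by simp
  rw [h1, sum_div, sum_div, ← sum_add_distrib]
  exact sum_congr rfl fun e _ => by ring

end MultiGraph

/-! ### Averaging over the random tree -/

/-- The mean cost of a random edge set is the cost of its incidence probabilities. -/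
theorem sum_mul_sum_eq {E : Type*} [Fintype E] [DecidableEq E] (𝓕 : Finset (Finset E))
    (lam : Finset E → ℝ) (S : Finset E → Finset E) (c : E → ℝ) :
    ∑ F ∈ 𝓕, lam F * ∑ e ∈ S F, c e = ∑ e, c e * ∑ F ∈ 𝓕 with e ∈ S F, lam F := by
  have h : ∀ F, ∑ e ∈ S F, c e = ∑ e, if e ∈ S F then c e else 0 := fun F => by simp
  simp only [h, sum_filter, mul_sum]
  rw [sum_comm]
  refine sum_congr rfl fun e _ => sum_congr rfl fun F _ => ?_
  split_ifs <;> ring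

theorem mainTheorem2 {V E : Type*} [Fintype V] [DecidableEq V] [Fintype E] [DecidableEq E]
    (G : MultiGraph V E) (hG : G.Connected)
    (T : Finset V) (hT : Even T.card)
    (c : E → ℝ) (hc : ∀ e, 0 ≤ c e)
    (x : E → ℝ) (hx : x ∈ G.tourPolyhedron T)
    (hmin : ∀ y ∈ G.tourPolyhedron T, c ⬝ᵥ x ≤ c ⬝ᵥ y)
    (𝓕 : Finset (Finset E)) (lam : Finset E → ℝ)
    (hlam : G.IsDominatedTreeDistribution x 𝓕 lam) :
    treeExpectation 𝓕 lam (fun F => G.tau (G.oddVertices F ∆ T) c) ≤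
        min (c ⬝ᵥ x - c ⬝ᵥ G.qStar T 𝓕 lam / 2) (c ⬝ᵥ G.qStar T 𝓕 lam) ∧
      min (c ⬝ᵥ x - c ⬝ᵥ G.qStar T 𝓕 lam / 2) (c ⬝ᵥ G.qStar T 𝓕 lam) ≤ 2 / 3 * (c ⬝ᵥ x) := by
  have hq : ∑ F ∈ 𝓕, lam F * ∑ e ∈ F \ G.treeJoin T F, c e = c ⬝ᵥ G.qStar T 𝓕 lam :=
    sum_mul_sum_eq 𝓕 lam (fun F => F \ G.treeJoin T F) c
  have htree : ∑ F ∈ 𝓕, lam F * ∑ e ∈ F, c e ≤ c ⬝ᵥ x := by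
    rw [sum_mul_sum_eq 𝓕 lam (fun F => F) c]
    exact sum_le_sum fun e _ => mul_le_mul_of_nonneg_left (hlam.dominated e) (hc e)
  have hsplit : ∑ F ∈ 𝓕, lam F * ∑ e ∈ F, c e =
      ∑ F ∈ 𝓕, lam F * ∑ e ∈ F \ G.treeJoin T F, c e +
        ∑ F ∈ 𝓕, lam F * ∑ e ∈ G.treeJoin T F, c e := by
    rw [← sum_add_distrib]
    refine sum_congr rfl fun F hF => ?_
    rw [← mul_add, sum_sdiff ((hlam.isSpanningTree F hF).treeJoin_spec hT).1]
  refine ⟨le_min ?_ ?_, ?_⟩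
  · calc treeExpectation 𝓕 lam (fun F => G.tau (G.oddVertices F ∆ T) c)
        ≤ ∑ F ∈ 𝓕, lam F * ((∑ e, c e * x e) / 2 + (∑ e ∈ G.treeJoin T F, c e) / 2) :=
          sum_le_sum fun F hF => mul_le_mul_of_nonneg_left
            (MultiGraph.tau_le_half hT hx (hlam.isSpanningTree F hF) hc) (hlam.pos F hF).le
      _ = (c ⬝ᵥ x) / 2 + (∑ F ∈ 𝓕, lam F * ∑ e ∈ G.treeJoin T F, c e) / 2 := by
          simp only [mul_add, sum_add_distrib]
          rw [← sum_mul, hlam.sum_eq_one, one_mul, sum_div 𝓕]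
          simp only [mul_div_assoc]
          rfl
      -- By `hsplit`, `hq` and `htree`, the mean cost of F(T) is at most c·x - c·q*.
      _ ≤ c ⬝ᵥ x - c ⬝ᵥ G.qStar T 𝓕 lam / 2 := by linarith
  · rw [← hq]
    exact sum_le_sum fun F hF => mul_le_mul_of_nonneg_left
      (MultiGraph.tau_le ((hlam.isSpanningTree F hF).isTJoin_sdiff_treeJoin hT) c)
      (hlam.pos F hF).le
  · rcases le_total (c ⬝ᵥ G.qStar T 𝓕 lam) (2 / 3 * (c ⬝ᵥ x)) with h | h
    · exact (min_le_right _ _).trans h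
    · exact (min_le_left _ _).trans (by linarith)
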